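/- \textbf{Conventions.} Let $p$ be a prime and let $S$ be an $F$-finite regular domain of characteristic $p$ ($F$-finite: the Frobenius endomorphism $x\mapsto x^p$ is a finite ring homomorphism); $q$ denotes a power $p^e$, $e\ge 0$. For an ideal $\mathfrak a\subseteq S$ put $\mathfrak a^{[q]}=\langle f^q: f\in\mathfrak a\rangle$, and let $\mathfrak a^{[1/q]}$ be the smallest ideal $\mathfrak c$ with $\mathfrak a\subseteq\mathfrak c^{[q]}$. For $k\in\mathbb N$ with base $p$ expansion $k=k_0+k_1p+\cdots+k_rp^r$ put $\mathfrak a^{[k]}=\prod_i (\mathfrak a^{k_i})^{[p^i]}$, and put $\mathfrak a^{[k/q]}=(\mathfrak a^{[k]})^{[1/q]}$. For real $t\ge 0$ the Frobenius power of $\mathfrak a$ and the test ideal of $\mathfrak a$ with exponent $t$ are the ascending unions $$\mathfrak a^{[t]}=\bigcup_{e\ge 0}\mathfrak a^{[\lceil p^et\rceil/p^e]},\qquad \tau(\mathfrak a^t)=\bigcup_{e\ge 0}\bigl(\mathfrak a^{\lceil p^et\rceil}\bigr)^{[1/p^e]}.$$ For a nonzero ideal $\mathfrak a$, the least critical exponent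 and the $F$-pure threshold are $$\operatorname{lce}(\mathfrak a)=\sup\{t>0:\mathfrak a^{[t]}=S\},\qquad \operatorname{fpt}(\mathfrak a)=\sup\{t>0:\tau(\mathfrak a^t)=S\}$$ in $[0,\infty]$. For $G\in S$ write $\tau(G^t)=\tau(\langle G\rangle^t)$ and $\operatorname{fpt}(G)=\operatorname{fpt}(\langle G\rangle)$. \textbf{Statement.} (1) Let $R$ be an $F$-finite regular domain of characteristic $p$, let $\mathfrak a=\langle g_1,\dots,g_m\rangle$ be a nonzero proper ideal of $R$, let $z=z_1,\dots,z_m$ be variables over $R$, and let $G=z_1g_1+\cdots+z_mg_m\in R[z]$. Then $\operatorname{lce}(\mathfrak a)=\operatorname{fpt}(G)$. (2) If moreover $\Bbbk$ is an $F$-finite field contained in $R$, then also $\operatorname{lce}(\mathfrak a)=\operatorname{fpt}(G)$ when $G$ is regarded as an element of $R\otimes_{\Bbbk}\Bbbk(z)$ and its $F$-pure threshold is computed in that ring. (3) Let $\Bbbk$ be an $F$-finite field of characteristic $p$, let $\mathfrak a=\langle g_1,\dots,g_m\rangle$ be an ideal of $\Bbbk[x]=\Bbbk[x_1,\dots,x_n]$,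 and let $G=z_1g_1+\cdots+z_mg_m\in\Bbbk(z)[x]$. If $0<t<1$, then $\tau(G^t)=\mathfrak a^{[t]}\cdot\Bbbk(z)[x]$ and $\mathfrak a^{[t]}=\tau(G^t)\cap\Bbbk[x]$. If $\mathfrak a$ is nonzero and proper, then $\operatorname{fpt}(G)=\operatorname{lce}(\mathfrak a)$. -/

import Mathlib

open scoped NNReal ENNReal TensorProduct

/-- A commutative ring of prime characteristic `p` is *`F`-finite* if its Frobenius endomorphism
`x ↦ x ^ p` is a finite ring homomorphism. -/
def IsFFinite (p : ℕ) (R : Type*) [CommRing R] [ExpChar R p] : Prop :=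
  (frobenius R p).Finite

namespace Ideal

variable {R : Type*} [CommRing R]

/-- The standard Frobenius power `𝔞^[q]`, for `q` a power of the characteristic: the ideal
generated by all `f ^ q` with `f ∈ 𝔞`. -/
def bracketPow (𝔞 : Ideal R) (q : ℕ) : Ideal R :=
  Ideal.span ((fun f : R => f ^ q) '' (𝔞 : Set R))

/-- The Frobenius root `𝔞^[1/q]`, for `q` a power of the characteristic: the smallest ideal `𝔠`
with `𝔞 ⊆ 𝔠^[q]`. In an `F`-finite regular ring the family of all such `𝔠` has a smallest member,
which is then the intersection of the family. -/
def bracketRoot (𝔞 : Ideal R) (q : ℕ) : Ideal R :=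
  sInf {𝔠 : Ideal R | 𝔞 ≤ 𝔠.bracketPow q}

/-- The integral Frobenius power `𝔞^[k]`: if `k = k₀ + k₁ p + ⋯ + kᵣ p ^ r` is the base `p`
expansion of `k`, this is the product of the ideals `(𝔞 ^ kᵢ)^[p ^ i]`. -/
def frobeniusPowNat (p : ℕ) (𝔞 : Ideal R) (k : ℕ) : Ideal R :=
  ∏ i ∈ Finset.range (Nat.digits p k).length,
    (𝔞 ^ (Nat.digits p k).getD i 0).bracketPow (p ^ i)

/-- The Frobenius power `𝔞^[k / p ^ e] = (𝔞^[k])^[1 / p ^ e]`. -/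
def frobeniusPowRat (p : ℕ) (𝔞 : Ideal R) (k e : ℕ) : Ideal R :=
  (𝔞.frobeniusPowNat p k).bracketRoot (p ^ e)

/-- The real Frobenius power `𝔞^[t]`, for `t ≥ 0`: the union of the ascending chain of the
`𝔞^[tₑ]`, where `tₑ = ⌈p ^ e t⌉ / p ^ e` decreases to `t`. -/
noncomputable def frobeniusPow (p : ℕ) (𝔞 : Ideal R) (t : ℝ≥0) : Ideal R :=
  ⨆ e : ℕ, 𝔞.frobeniusPowRat p ⌈(p : ℝ≥0) ^ e * t⌉₊ e

/-- The test ideal `τ(𝔞 ^ t)`, for `t ≥ 0`, in the form valid in an `F`-finite regular ring: the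
union of the ascending chain of the ideals `(𝔞 ^ ⌈p ^ e t⌉)^[1 / p ^ e]`. -/
noncomputable def testIdeal (p : ℕ) (𝔞 : Ideal R) (t : ℝ≥0) : Ideal R :=
  ⨆ e : ℕ, (𝔞 ^ ⌈(p : ℝ≥0) ^ e * t⌉₊).bracketRoot (p ^ e)

/-- The `F`-pure threshold: the supremum, in `[0, ∞]`, of all `t > 0` with `τ(𝔞 ^ t) = R`. -/
noncomputable def fpt (p : ℕ) (𝔞 : Ideal R) : ℝ≥0∞ :=
  sSup ((fun t : ℝ≥0 => (t : ℝ≥0∞)) '' {t : ℝ≥0 | 0 < t ∧ 𝔞.testIdeal p t = ⊤})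

/-- The least critical exponent: the supremum, in `[0, ∞]`, of all `t > 0` with `𝔞^[t] = R`. -/
noncomputable def lce (p : ℕ) (𝔞 : Ideal R) : ℝ≥0∞ :=
  sSup ((fun t : ℝ≥0 => (t : ℝ≥0∞)) '' {t : ℝ≥0 | 0 < t ∧ 𝔞.frobeniusPow p t = ⊤})

end Ideal

/-- The field `k(z) = k(z₁, …, zₘ)` of rational functions. -/
abbrev RatFunField (m : ℕ) (k : Type*) [Field k] : Type _ :=
  FractionRing (MvPolynomial (Fin m) k)

/-- The variable `zᵢ` of `k(z)`. -/
noncomputable def ratVar (k : Type*) [Field k] {m : ℕ} (i : Fin m) : RatFunField m k :=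
  algebraMap (MvPolynomial (Fin m) k) (RatFunField m k) (MvPolynomial.X i)

/-- The generic linear combination `z₁ g₁ + ⋯ + zₘ gₘ` in `R[z₁, …, zₘ]`. -/
noncomputable def genericComb {R : Type*} [CommRing R] {m : ℕ} (g : Fin m → R) :
    MvPolynomial (Fin m) R :=
  ∑ i, MvPolynomial.X i * MvPolynomial.C (g i)

/-- The generic linear combination `z₁ g₁ + ⋯ + zₘ gₘ` in `R ⊗ₖ k(z₁, …, zₘ)`. -/
noncomputable def genericCombTensor (k : Type*) [Field k] {R : Type*} [CommRing R] [Algebra k R]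
    {m : ℕ} (g : Fin m → R) : R ⊗[k] RatFunField m k :=
  ∑ i, g i ⊗ₜ[k] ratVar k i

/-- The inclusion `k[x₁, …, xₙ] → k(z₁, …, zₘ)[x₁, …, xₙ]`. -/
noncomputable def polyIncl (k : Type*) [Field k] (m n : ℕ) :
    MvPolynomial (Fin n) k →+* MvPolynomial (Fin n) (RatFunField m k) :=
  MvPolynomial.map (algebraMap k (RatFunField m k))

/-- The generic linear combination `z₁ g₁ + ⋯ + zₘ gₘ` in `k(z₁, …, zₘ)[x₁, …, xₙ]`. -/
noncomputable def genericCombPoly {k : Type*} [Field k] {m n : ℕ}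
    (g : Fin m → MvPolynomial (Fin n) k) : MvPolynomial (Fin n) (RatFunField m k) :=
  ∑ i, MvPolynomial.C (ratVar k i) * polyIncl k m n (g i)

/-! ### Flatness of Frobenius on a regular ring -/

section RegularLocal

open IsLocalRing Pointwise

/-! Everything rests on one identity: the coefficients of `G ^ k` in the variables `z` generate
`𝔞^[k]` (`coeffIdeal_genericComb_pow`). For `k < p` the multinomial coefficients are units, so `𝔞 ^
k` appears. In general `G ^ k = G ^ (k % p) * (G ^ (k / p)) ^ p`, and the first factor has
`z`-exponents below `p`, so no monomials collide and the digits separate.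

If `k < q = p ^ e`, the monomials of `G ^ k` have exponents below `q`. Hence membership of `G ^ k`
in `J^[q]` can be tested coefficient by coefficient, and `(G ^ k)^[1/q]` is the extension of
`𝔞^[k/q]`. For `t < 1` the bound `⌈p ^ e t⌉ < p ^ e` holds for large `e`, so `τ(G ^ t)` is the
extension of `𝔞^[t]` (`testIdeal_genericComb_eq_map`). For `t ≥ 1` both ideals are proper, since
they lie in `𝔞` and its extension. As ideals of `R` are contracted from the larger ring, the
thresholds agree. The argument works over any localization `T` of `R[z]`, which covers `R[z]`, `R ⊗
k(z)` and `k(z)[x]` at once.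

Regularity and `F`-finiteness of `R` enter through Kunz's theorem: Frobenius is finite flat, hence
projective, and a dual basis `φ i`, `b i` gives `x ∈ J^[q]` iff every `φ i x ∈ J`. Flatness is
checked at primes by cutting down with some `x ∈ 𝔪 \ 𝔪²`. -/

theorem IsLocalRing.exists_mem_generators_mem_span_insert {A : Type*} [CommRing A] [IsLocalRing A]
    {S : Finset A} (hS : Ideal.span (S : Set A) = maximalIdeal A) {x : A}
    (hx : x ∈ maximalIdeal A) (hx2 : x ∉ maximalIdeal A ^ 2) :
    ∃ y ∈ S, y ∈ Ideal.span (insert x ((S : Set A) \ {y})) := by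
  classical
  rw [← hS] at hx
  obtain ⟨a, -, hxa⟩ := Submodule.mem_span_finset.1 hx
  have hy : ∃ y ∈ S, a y ∉ maximalIdeal A := by
    by_contra! h
    refine hx2 ?_
    rw [← hxa, pow_two]
    refine Ideal.sum_mem _ fun y hy => Ideal.mul_mem_mul (h y hy) ?_
    rw [← hS]
    exact Ideal.subset_span hy
  obtain ⟨y, hyS, hy⟩ := hy
  refine ⟨y, hyS, ?_⟩
  have hu : IsUnit (a y) := by simpa using hy
  have hmem : a y * y ∈ Ideal.span (insert x ((S : Set A) \ {y})) := by
    have : a y * y = x - ∑ s ∈ S.erase y, a s * s := by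
      rw [← hxa, ← Finset.add_sum_erase S _ hyS]
      simp
    rw [this]
    refine Ideal.sub_mem _ (Ideal.subset_span (Set.mem_insert _ _)) (Ideal.sum_mem _ fun s hs => ?_)
    refine Ideal.mul_mem_left _ _ (Ideal.subset_span (Set.mem_insert_of_mem _ ?_))
    simpa [and_comm] using hs
  exact (Ideal.unit_mul_mem_iff_mem _ hu).1 hmem

/-- Since `x` can replace a minimal generator, the embedding dimension drops by at least one. The
Krull dimension drops by at most one, so regularity of `A` forces equality throughout. -/
theorem IsRegularLocalRing.quotient_span_singleton {A : Type*} [CommRing A] [IsRegularLocalRing A]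
    {x : A} (hx : x ∈ maximalIdeal A) (hx2 : x ∉ maximalIdeal A ^ 2) :
    IsRegularLocalRing (A ⧸ Ideal.span {x}) ∧
      (maximalIdeal A).spanFinrank = ringKrullDim (A ⧸ Ideal.span {x}) + 1 := by
  classical
  have hnt : Nontrivial (A ⧸ Ideal.span {x}) := Ideal.Quotient.nontrivial_iff.2 fun h =>
    (maximalIdeal.isMaximal A).ne_top (top_le_iff.1 (h ▸ (Ideal.span_singleton_le_iff_mem _).2 hx))
  have : IsLocalRing (A ⧸ Ideal.span {x}) :=
    IsLocalRing.of_surjective' (Ideal.Quotient.mk _) Ideal.Quotient.mk_surjective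
  have hmap : (maximalIdeal A).map (Ideal.Quotient.mk (Ideal.span {x})) =
      maximalIdeal (A ⧸ Ideal.span {x}) :=
    IsLocalRing.map_maximalIdeal_of_surjective _ Ideal.Quotient.mk_surjective
  have hfg : (maximalIdeal A).FG := (maximalIdeal A).fg_of_isNoetherianRing
  obtain ⟨S, hcard, hS⟩ := Submodule.FG.exists_span_finset_card_eq_spanFinrank hfg
  obtain ⟨y, hyS, hy⟩ := IsLocalRing.exists_mem_generators_mem_span_insert hS hx hx2
  have hgen : maximalIdeal (A ⧸ Ideal.span {x}) =
      Ideal.span (((S.erase y).image (Ideal.Quotient.mk (Ideal.span {x})) : Finset _) :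
        Set (A ⧸ Ideal.span {x})) := by
    refine le_antisymm ?_ ?_
    · rw [← hmap, ← hS, Ideal.submodule_span_eq, Ideal.map_span, Ideal.span_le]
      have hle : ∀ s ∈ (S : Set A), s ∈ Ideal.span (insert x ((S : Set A) \ {y})) := by
        intro s hs
        by_cases h : s = y
        · exact h ▸ hy
        · exact Ideal.subset_span (Set.mem_insert_of_mem _ ⟨hs, h⟩)
      rintro _ ⟨s, hs, rfl⟩
      have := Ideal.mem_map_of_mem (Ideal.Quotient.mk (Ideal.span {x})) (hle s hs)
      rw [Ideal.map_span, Set.image_insert_eq,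
        Ideal.Quotient.eq_zero_iff_mem.2 (Ideal.mem_span_singleton_self x)] at this
      simpa [Ideal.span_insert] using this
    · rw [← hmap, Ideal.span_le]
      intro s hs
      simp only [Finset.coe_image, Set.mem_image, Finset.mem_coe] at hs
      obtain ⟨t, ht, rfl⟩ := hs
      refine Ideal.mem_map_of_mem _ ?_
      rw [← hS]
      exact Ideal.subset_span (Finset.mem_of_mem_erase ht)
  have hrank : (maximalIdeal (A ⧸ Ideal.span {x})).spanFinrank + 1 ≤
      (maximalIdeal A).spanFinrank := by
    rw [← hcard, ← Finset.card_erase_add_one hyS, hgen]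
    gcongr
    refine (Submodule.spanFinrank_span_le_ncard_of_finite (Finset.finite_toSet _)).trans ?_
    rw [Set.ncard_coe_finset]
    exact Finset.card_image_le
  have hdim : ringKrullDim A ≤ ringKrullDim (A ⧸ Ideal.span {x}) + 1 := by
    rw [← IsLocalRing.maximalIdeal_height_eq_ringKrullDim]
    exact Ideal.height_le_ringKrullDim_quotient_add_one hx
  have hreg := (isRegularLocalRing_iff A).1 inferInstance
  have hle := ringKrullDim_le_spanFinrank_maximalIdeal (A ⧸ Ideal.span {x})
  have h1 : (((maximalIdeal (A ⧸ Ideal.span {x})).spanFinrank : WithBot ℕ∞)) + 1 ≤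
      (maximalIdeal A).spanFinrank := by exact_mod_cast hrank
  have h2 : (maximalIdeal A).spanFinrank = ringKrullDim (A ⧸ Ideal.span {x}) + 1 := by
    refine le_antisymm (hreg ▸ hdim) (le_trans ?_ h1)
    gcongr
  refine ⟨IsRegularLocalRing.of_spanFinrank_maximalIdeal_le _ ?_, h2⟩
  rw [h2] at h1
  exact ENat.WithBot.add_le_add_one_right_iff.1 h1

/-- Choose `x ∈ 𝔪` outside `𝔪²` and all minimal primes. By induction `(x)` is prime, so it contains
a minimal prime `Q`; as `x ∉ Q`, this gives `Q = xQ`, and Nakayama yields `Q = 0`. -/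
theorem IsRegularLocalRing.isDomain (A : Type*) [CommRing A] [IsRegularLocalRing A] :
    IsDomain A := by
  induction hn : (maximalIdeal A).spanFinrank generalizing A with
  | zero =>
    have hbot : maximalIdeal A = ⊥ :=
      (Submodule.spanFinrank_eq_zero_iff_eq_bot (maximalIdeal A).fg_of_isNoetherianRing).1 hn
    exact (IsLocalRing.isField_iff_maximalIdeal_eq.2 hbot).isDomain
  | succ n ih =>
    have hreg := (isRegularLocalRing_iff A).1 inferInstance
    have hfin : (minimalPrimes A).Finite := minimalPrimes.finite_of_isNoetherianRing A
    have hex : ¬ ((maximalIdeal A : Set A) ⊆ ⋃ I ∈ insert (maximalIdeal A ^ 2) (minimalPrimes A),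
        ((I : Ideal A) : Set A)) := by
      -- Prime avoidance tolerates two non-prime ideals; `𝔪²` fills both slots.
      rw [Ideal.subset_union_prime_finite (hfin.insert _) (maximalIdeal A ^ 2)
        (maximalIdeal A ^ 2) (fun I hI h _ => ((Set.mem_insert_iff.1 hI).resolve_left h).1.1)]
      rintro ⟨I, hI, hle⟩
      have hne : maximalIdeal A ≠ ⊥ := by
        intro h
        rw [h] at hn
        simp at hn
      rcases Set.mem_insert_iff.1 hI with rfl | hI
      · refine hne (Submodule.eq_bot_of_le_smul_of_le_jacobson_bot (maximalIdeal A) _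
          (maximalIdeal A).fg_of_isNoetherianRing ?_ (IsLocalRing.maximalIdeal_le_jacobson _))
        rwa [smul_eq_mul, ← pow_two]
      · have hIp : I.IsPrime := hI.1.1
        have hI' : I = maximalIdeal A :=
          ((maximalIdeal.isMaximal A).eq_of_le hI.1.1.ne_top hle).symm
        have h0 : I.height = 0 := Ideal.height_eq_zero_iff.2 hI
        rw [← IsLocalRing.maximalIdeal_height_eq_ringKrullDim, ← hI', h0, hI', hn] at hreg
        norm_cast at hreg
    obtain ⟨x, hxm, hx⟩ := Set.not_subset.1 hex
    simp only [Set.mem_insert_iff, Set.iUnion_iUnion_eq_or_left, Set.mem_union, SetLike.mem_coe,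
      Set.mem_iUnion, not_or, not_exists] at hx
    obtain ⟨hr, hd⟩ := IsRegularLocalRing.quotient_span_singleton hxm hx.1
    have hdom : IsDomain (A ⧸ Ideal.span {x}) := by
      refine ih _ ?_
      rw [← (isRegularLocalRing_iff _).1 hr, hn] at hd
      norm_cast at hd
      omega
    have hprime : (Ideal.span {x}).IsPrime := (Ideal.Quotient.isDomain_iff_prime _).1 hdom
    obtain ⟨Q, hQ, hQx⟩ := Ideal.exists_minimalPrimes_le (I := (⊥ : Ideal A)) (bot_le : _ ≤ Ideal.span {x})
    have hQp : Q.IsPrime := hQ.1.1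
    have hxQ : x ∉ Q := fun h => hx.2 Q hQ h
    have hQ0 : Q = ⊥ := by
      refine Submodule.eq_bot_of_le_smul_of_le_jacobson_bot (Ideal.span {x}) _
        Q.fg_of_isNoetherianRing ?_ (((Ideal.span_singleton_le_iff_mem _).2 hxm).trans
          (IsLocalRing.maximalIdeal_le_jacobson _))
      intro y hy
      obtain ⟨z, rfl⟩ := Ideal.mem_span_singleton'.1 (hQx hy)
      rw [smul_eq_mul, mul_comm z]
      exact Ideal.mul_mem_mul (Ideal.mem_span_singleton_self x)
        ((hQp.mem_or_mem hy).resolve_right hxQ)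
    subst hQ0
    exact IsDomain.of_bot_isPrime A

theorem Module.Free.of_exact {R M N P : Type*} [Ring R] [AddCommGroup M] [AddCommGroup N]
    [AddCommGroup P] [Module R M] [Module R N] [Module R P] {f : M →ₗ[R] N} {g : N →ₗ[R] P}
    (hfg : Function.Exact f g) (hf : Function.Injective f) (hg : Function.Surjective g)
    [Module.Free R M] [Module.Free R P] : Module.Free R N := by
  obtain ⟨l, hl⟩ := Module.projective_lifting_property g LinearMap.id hg
  exact Module.Free.of_equiv (hfg.splitSurjectiveEquiv hf ⟨l, hl⟩).1.symm

/-- The filtration by powers of `y` has all its graded pieces isomorphic to `C/y`: by `hy`, the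
sequences `0 → C/y → C/y^(j+1) → C/y^j → 0` are exact, and they split because the right end is free
by induction. -/
theorem Module.Free.of_quotient_span_singleton {A C : Type*} [CommRing A] [CommRing C] [Algebra A C]
    (y : C) (n : ℕ) (hn : y ^ n = 0)
    (hy : ∀ j < n, ∀ c, y ^ j * c ∈ Ideal.span {y ^ (j + 1)} → c ∈ Ideal.span {y})
    [Module.Free A (C ⧸ Ideal.span {y})] : Module.Free A C := by
  have key : ∀ j ≤ n, Module.Free A (C ⧸ Ideal.span {y ^ j}) := by
    intro j
    induction j with
    | zero =>
      intro _
      have : Subsingleton (C ⧸ Ideal.span {y ^ 0}) := by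
        rw [Ideal.Quotient.subsingleton_iff, pow_zero, Ideal.span_singleton_one]
      infer_instance
    | succ j ih =>
      intro hj
      have := ih (by omega)
      let f : (C ⧸ (Ideal.span {y} : Ideal C)) →ₗ[C] (C ⧸ (Ideal.span {y ^ (j + 1)} : Ideal C)) :=
        Submodule.mapQ (Ideal.span {y}) (Ideal.span {y ^ (j + 1)}) (LinearMap.mulLeft C (y ^ j))
          ((Submodule.span_singleton_le_iff_mem _ _).2 (by
            change y ^ j * y ∈ Ideal.span {y ^ (j + 1)}
            rw [← pow_succ]
            exact Ideal.mem_span_singleton_self _))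
      let g : (C ⧸ Ideal.span {y ^ (j + 1)}) →ₗ[C] (C ⧸ Ideal.span {y ^ j}) :=
        Submodule.mapQ (Ideal.span {y ^ (j + 1)}) (Ideal.span {y ^ j}) LinearMap.id
          (Ideal.span_singleton_le_span_singleton.2 (pow_dvd_pow y j.le_succ))
      have hf : ∀ c : C, f (Ideal.Quotient.mk _ c) = Ideal.Quotient.mk _ (y ^ j * c) :=
        fun c => rfl
      have hg : ∀ c : C, g (Ideal.Quotient.mk _ c) = Ideal.Quotient.mk _ c := fun c => rfl
      refine Module.Free.of_exact (f := f.restrictScalars A) (g := g.restrictScalars A) ?_ ?_ ?_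
      · intro c
        obtain ⟨c, rfl⟩ := Ideal.Quotient.mk_surjective c
        rw [LinearMap.restrictScalars_apply, hg, Ideal.Quotient.eq_zero_iff_mem]
        constructor
        · intro hc
          obtain ⟨d, rfl⟩ := Ideal.mem_span_singleton.1 hc
          exact ⟨Ideal.Quotient.mk _ d, hf d⟩
        · rintro ⟨d, hd⟩
          obtain ⟨d, rfl⟩ := Ideal.Quotient.mk_surjective d
          rw [LinearMap.restrictScalars_apply, hf, Ideal.Quotient.eq] at hd
          have h1 := Ideal.span_singleton_le_span_singleton.2 (pow_dvd_pow y j.le_succ) hd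
          have h2 := Ideal.mul_mem_right d _ (Ideal.mem_span_singleton_self (y ^ j))
          simpa using Ideal.sub_mem _ h2 h1
      · rw [← LinearMap.ker_eq_bot, eq_bot_iff]
        intro c hc
        obtain ⟨c, rfl⟩ := Ideal.Quotient.mk_surjective c
        rw [LinearMap.mem_ker, LinearMap.restrictScalars_apply, hf,
          Ideal.Quotient.eq_zero_iff_mem] at hc
        exact Ideal.Quotient.eq_zero_iff_mem.2 (hy j (by omega) c hc)
      · intro c
        obtain ⟨c, rfl⟩ := Ideal.Quotient.mk_surjective c
        exact ⟨Ideal.Quotient.mk _ c, hg c⟩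
  have := key n le_rfl
  have hbot : Ideal.span {y ^ n} = ⊥ := by simp [hn]
  exact Module.Free.of_equiv
    ((Submodule.quotEquivOfEqBot (Ideal.span {y ^ n}) hbot).restrictScalars A)

/-- Source and target are kept as separate rings related by `e`, so that the induction can pass to
`A/x → B/y` with `y = e x`. Freeness of `B/y` over `A/x` climbs along powers of `y` to `B/y^p =
B/xB`, and then lifts to `B`. -/
theorem IsRegularLocalRing.free_frobenius {p : ℕ} (hp : p ≠ 0) (A B : Type*) [CommRing A]
    [CommRing B] [IsRegularLocalRing A] [Algebra A B] [Module.Finite A B] (e : A ≃+* B)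
    (he : ∀ a, algebraMap A B a = e a ^ p) : Module.Free A B := by
  induction hn : (maximalIdeal A).spanFinrank generalizing A B with
  | zero =>
    have hbot : maximalIdeal A = ⊥ :=
      (Submodule.spanFinrank_eq_zero_iff_eq_bot (maximalIdeal A).fg_of_isNoetherianRing).1 hn
    let _ := (IsLocalRing.isField_iff_maximalIdeal_eq.2 hbot).toField
    infer_instance
  | succ n ih =>
    have hdom := IsRegularLocalRing.isDomain A
    have hne : ¬ maximalIdeal A ≤ maximalIdeal A ^ 2 := by
      intro hle
      have : maximalIdeal A = ⊥ := by
        refine Submodule.eq_bot_of_le_smul_of_le_jacobson_bot (maximalIdeal A) _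
          (maximalIdeal A).fg_of_isNoetherianRing ?_ (IsLocalRing.maximalIdeal_le_jacobson _)
        rwa [smul_eq_mul, ← pow_two]
      rw [this] at hn
      simp at hn
    obtain ⟨x, hxm, hx2⟩ := Set.not_subset.1 hne
    obtain ⟨hr, hd⟩ := IsRegularLocalRing.quotient_span_singleton hxm hx2
    have hBdom : IsDomain B := e.symm.toMulEquiv.isDomain A
    have hx0 : x ≠ 0 := by
      rintro rfl
      exact hx2 (zero_mem _)
    obtain ⟨y, hy⟩ : ∃ y, e x = y := ⟨_, rfl⟩
    have hy0 : y ≠ 0 := by simpa [← hy] using hx0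
    have hxB : algebraMap A B x = y ^ p := by rw [he, hy]
    have hle : Ideal.span {x} ≤ (Ideal.span {y ^ p}).comap (algebraMap A B) := by
      rw [Ideal.span_singleton_le_iff_mem, Ideal.mem_comap, hxB]
      exact Ideal.mem_span_singleton_self _
    let _ : Algebra (A ⧸ Ideal.span {x}) (B ⧸ Ideal.span {y ^ p}) :=
      (Ideal.quotientMap _ (algebraMap A B) hle).toAlgebra
    have : IsScalarTower A (A ⧸ Ideal.span {x}) (B ⧸ Ideal.span {y ^ p}) :=
      IsScalarTower.of_algebraMap_eq fun a => rfl
    have hdvd : ∀ b : B, Ideal.Quotient.mk (Ideal.span {y ^ p}) b ∈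
        Ideal.span {Ideal.Quotient.mk (Ideal.span {y ^ p}) (y)} → y ∣ b := by
      intro b hb
      obtain ⟨c, hc⟩ := Ideal.mem_span_singleton.1 hb
      obtain ⟨c, rfl⟩ := Ideal.Quotient.mk_surjective c
      rw [← map_mul, Ideal.Quotient.eq, Ideal.mem_span_singleton] at hc
      exact (dvd_sub_left (dvd_mul_right (y) c)).1 ((dvd_pow_self (y) hp).trans hc)
    let ψ : A →+* (B ⧸ Ideal.span {y ^ p}) ⧸
        Ideal.span {Ideal.Quotient.mk (Ideal.span {y ^ p}) (y)} :=
      ((Ideal.Quotient.mk _).comp (Ideal.Quotient.mk _)).comp (e : A →+* B)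
    have hψ : Function.Surjective ψ :=
      (Ideal.Quotient.mk_surjective.comp Ideal.Quotient.mk_surjective).comp e.surjective
    have hker : Ideal.span {x} = RingHom.ker ψ := by
      ext a
      rw [RingHom.mem_ker, Ideal.mem_span_singleton]
      refine ⟨?_, fun h => ?_⟩
      · rintro ⟨c, rfl⟩
        refine Ideal.Quotient.eq_zero_iff_mem.2 ?_
        simpa [hy] using Ideal.mul_mem_right _ _ (Ideal.mem_span_singleton_self _)
      · rw [← map_dvd_iff e, hy]
        exact (hdvd _ (Ideal.Quotient.eq_zero_iff_mem.1 h))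
    have hfin : Module.Finite (A ⧸ Ideal.span {x}) (B ⧸ Ideal.span {y ^ p}) :=
      Module.Finite.of_restrictScalars_finite A _ _
    have hfree : Module.Free (A ⧸ Ideal.span {x}) ((B ⧸ Ideal.span {y ^ p}) ⧸
        Ideal.span {Ideal.Quotient.mk (Ideal.span {y ^ p}) (y)}) := by
      refine ih _ _ ((Ideal.quotEquivOfEq hker).trans
        (RingHom.quotientKerEquivOfSurjective hψ)) ?_ ?_
      · intro a
        obtain ⟨a, rfl⟩ := Ideal.Quotient.mk_surjective a
        change Ideal.Quotient.mk _ (Ideal.Quotient.mk _ (algebraMap A B a)) = ψ a ^ p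
        rw [he, map_pow, map_pow]
        rfl
      · rw [← (isRegularLocalRing_iff _).1 hr, hn] at hd
        norm_cast at hd
        omega
    have hC : Module.Free (A ⧸ Ideal.span {x}) (B ⧸ Ideal.span {y ^ p}) := by
      refine Module.Free.of_quotient_span_singleton
        (Ideal.Quotient.mk (Ideal.span {y ^ p}) (y)) p ?_ ?_
      · rw [← map_pow, Ideal.Quotient.eq_zero_iff_mem]
        exact Ideal.mem_span_singleton_self _
      · intro j hj c hc
        obtain ⟨c, rfl⟩ := Ideal.Quotient.mk_surjective c
        obtain ⟨d, hd⟩ := Ideal.mem_span_singleton.1 hc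
        obtain ⟨d, rfl⟩ := Ideal.Quotient.mk_surjective d
        rw [← map_pow, ← map_pow, ← map_mul, ← map_mul, Ideal.Quotient.eq,
          Ideal.mem_span_singleton] at hd
        have h1 : y ^ (j + 1) ∣ y ^ j * c :=
          (dvd_sub_left (dvd_mul_right _ d)).1 ((pow_dvd_pow _ hj).trans hd)
        rw [pow_succ, mul_dvd_mul_iff_left (pow_ne_zero j hy0)] at h1
        exact Ideal.mem_span_singleton.2 (map_dvd _ h1)
    have heq : (x • ⊤ : Submodule A B) = (Ideal.span {y ^ p}).restrictScalars A := by
      ext b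
      simp [Submodule.mem_smul_pointwise_iff_exists, Algebra.smul_def, hxB,
        Ideal.mem_span_singleton, dvd_def, eq_comm]
    have hq : Module.Free (A ⧸ Ideal.span {x}) (QuotSMulTop x B) :=
      Module.Free.of_equiv (LinearEquiv.extendScalarsOfSurjective (R := A)
        Ideal.Quotient.mk_surjective ((Submodule.quotEquivOfEq _ _ heq).trans
          (Submodule.Quotient.restrictScalarsEquiv A (Ideal.span {y ^ p}))).symm)
    have := Module.finitePresentation_of_finite A B
    -- Freeness lifts from `B/xB` because `x` lies in the Jacobson radical and is regular on `B`.
    refine (Module.free_quotSMulTop_iff_free A B (x := x) ?_ ?_).1 hq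
    · exact IsLocalRing.maximalIdeal_le_jacobson _ hxm
    · intro b c hbc
      simpa [Algebra.smul_def, hxB, hy0, hp] using hbc

theorem RingHom.Finite.exists_generators {R S : Type*} [CommRing R] [CommRing S] {f : R →+* S}
    (hfin : f.Finite) : ∃ (n : ℕ) (b : Fin n → S), ∀ x, ∃ a : Fin n → R, x = ∑ i, f (a i) * b i := by
  algebraize [f]
  obtain ⟨n, b, hb⟩ := Module.Finite.exists_fin (R := R) (M := S)
  refine ⟨n, b, fun x => ?_⟩
  obtain ⟨a, ha⟩ := (Submodule.mem_span_range_iff_exists_fun R).1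
    (hb.symm ▸ Submodule.mem_top : x ∈ Submodule.span R (Set.range b))
  exact ⟨a, by simp only [← ha, Algebra.smul_def]; rfl⟩

/-- Flatness is local, and every prime is its own preimage under Frobenius, so the localized map is
again a `p`-th power up to the identification `e`. -/
theorem IsRegularRing.flat_frobenius (p : ℕ) (hp : p ≠ 0) (R : Type*) [CommRing R]
    [IsRegularRing R] [ExpChar R p] (hR : (frobenius R p).Finite) : (frobenius R p).Flat := by
  refine RingHom.Flat.ofLocalizationPrime _ fun P hP => ?_
  have hcomap : P.comap (frobenius R p) = P := by
    ext x
    rw [Ideal.mem_comap, frobenius_def]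
    exact hP.pow_mem_iff_mem _ (Nat.pos_of_ne_zero hp)
  set f := Localization.localRingHom (P.comap (frobenius R p)) P (frobenius R p) rfl with hf
  let _ := f.toAlgebra
  let e : Localization.AtPrime (P.comap (frobenius R p)) ≃+* Localization.AtPrime P :=
    IsLocalization.ringEquivOfRingEquiv (M := (P.comap (frobenius R p)).primeCompl)
      (T := P.primeCompl) _ _ (RingEquiv.refl R) (by
        ext x
        simp [hcomap])
  have he : ∀ x, f x = e x ^ p := by
    intro x
    obtain ⟨r, s, rfl⟩ := IsLocalization.exists_mk'_eq (P.comap (frobenius R p)).primeCompl x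
    rw [hf, Localization.localRingHom_mk', IsLocalization.ringEquivOfRingEquiv_mk',
      ← IsLocalization.mk'_pow]
    rfl
  have hfin : Module.Finite (Localization.AtPrime (P.comap (frobenius R p)))
      (Localization.AtPrime P) := by
    obtain ⟨n, b, hb⟩ := hR.exists_generators
    refine Module.finite_def.2 (Submodule.fg_def.2 ⟨Set.range fun i => algebraMap R _ (b i),
      Set.finite_range _, eq_top_iff.2 fun x _ => ?_⟩)
    obtain ⟨r, s, rfl⟩ := IsLocalization.exists_mk'_eq P.primeCompl x
    have hs : (s : R) ∈ (P.comap (frobenius R p)).primeCompl := by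
      change (s : R) ∉ P.comap (frobenius R p)
      rw [hcomap]
      exact s.2
    -- Writing `r/s = s^(p-1) r / s^p` makes the denominator a `p`-th power.
    obtain ⟨a, ha⟩ := hb ((s : R) ^ (p - 1) * r)
    have hx : IsLocalization.mk' (Localization.AtPrime P) r s =
        ∑ i, (IsLocalization.mk' (Localization.AtPrime (P.comap (frobenius R p))) (a i) ⟨s, hs⟩) •
          algebraMap R (Localization.AtPrime P) (b i) := by
      simp only [Algebra.smul_def]
      change _ = ∑ i, f _ * _
      rw [IsLocalization.mk'_eq_iff_eq_mul]
      have hu : IsUnit (algebraMap R (Localization.AtPrime P) (s ^ p)) :=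
        IsLocalization.map_units _ (s ^ p)
      have hmk : ∀ z : R, f (IsLocalization.mk' _ z ⟨s, hs⟩) * algebraMap R _ (s ^ p) =
          algebraMap R _ (frobenius R p z) := by
        intro z
        rw [← frobenius_def, ← Localization.localRingHom_to_map (P.comap (frobenius R p)) P
          (frobenius R p) rfl, ← hf, ← map_mul, IsLocalization.mk'_spec _ z ⟨(s : R), hs⟩, hf,
          Localization.localRingHom_to_map]
      refine hu.mul_right_cancel ?_
      rw [mul_right_comm, Finset.sum_mul]
      simp only [mul_right_comm _ (algebraMap R (Localization.AtPrime P) (b _))]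
      simp only [hmk, ← map_mul, ← map_sum]
      rw [← ha]
      congr 1
      obtain ⟨m, rfl⟩ := Nat.exists_eq_succ_of_ne_zero hp
      simp only [Nat.succ_eq_add_one, Nat.add_sub_cancel]
      ring
    rw [hx]
    exact Submodule.sum_mem _ fun i _ =>
      Submodule.smul_mem _ _ (Submodule.subset_span (Set.mem_range_self i))
  have := IsRegularLocalRing.free_frobenius hp _ _ e he
  have : f.Flat := (inferInstance : Module.Flat (Localization.AtPrime (P.comap (frobenius R p)))
      (Localization.AtPrime P))
  exact this

end RegularLocal

/-- Finite flat over a Noetherian ring is projective; the coordinates of a splitting of `R^n → S`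
form the dual basis. -/
theorem RingHom.Finite.exists_dual_system {R S : Type*} [CommRing R] [CommRing S]
    [IsNoetherianRing R] {f : R →+* S} (hfin : f.Finite) (hflat : f.Flat) :
    ∃ (n : ℕ) (φ : Fin n → S →+ R) (b : Fin n → S),
      (∀ i r x, φ i (f r * x) = r * φ i x) ∧ ∀ x, x = ∑ i, f (φ i x) * b i := by
  algebraize [f]
  have := Module.finitePresentation_of_finite R S
  have hproj : Module.Projective R S := Module.Flat.projective_of_finitePresentation
  obtain ⟨n, g, h, hg, hh, hgh⟩ := Module.Finite.exists_comp_eq_id_of_projective R S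
  refine ⟨n, fun i => ((LinearMap.proj i).comp h).toAddMonoidHom, fun i => g (Pi.single i 1),
    ?_, ?_⟩
  · intro i r x
    have : f r * x = r • x := (Algebra.smul_def r x).symm
    simp [this]
  · intro x
    conv_lhs => rw [← LinearMap.id_apply (R := R) x, ← hgh, LinearMap.comp_apply,
      ← Finset.univ_sum_single (h x), map_sum]
    refine Finset.sum_congr rfl fun i _ => ?_
    have : f (h x i) * g (Pi.single i 1) = h x i • g (Pi.single i 1) :=
      (Algebra.smul_def _ _).symm
    rw [LinearMap.toAddMonoidHom_coe, LinearMap.comp_apply, LinearMap.proj_apply, this,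
      ← map_smul, ← Pi.single_smul, smul_eq_mul, mul_one]

/-- A dual system for the `q`-th power map: the maps `φ i` and the elements `b i` exhibit a ring as
a finite projective module over itself by way of `r ↦ r ^ q`. -/
structure IsDualSystem {R ι : Type*} [CommRing R] [Fintype ι] (q : ℕ) (φ : ι → R →+ R)
    (b : ι → R) : Prop where
  map_pow_mul : ∀ i r x, φ i (r ^ q * x) = r * φ i x
  sum_eq : ∀ x, x = ∑ i, φ i x ^ q * b i

theorem IsRegularRing.exists_isDualSystem (p : ℕ) [Fact p.Prime] (R : Type*) [CommRing R]
    [IsRegularRing R] [ExpChar R p] (hR : IsFFinite p R) (e : ℕ) :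
    ∃ (n : ℕ) (φ : Fin n → R →+ R) (b : Fin n → R), IsDualSystem (p ^ e) φ b := by
  have hflat := IsRegularRing.flat_frobenius p (Fact.out : p.Prime).ne_zero R hR
  have key : (iterateFrobenius R p e).Finite ∧ (iterateFrobenius R p e).Flat := by
    induction e with
    | zero =>
      have : iterateFrobenius R p 0 = RingHom.id R := by
        ext x
        simp
      rw [this]
      exact ⟨RingHom.Finite.id R, RingHom.Flat.id R⟩
    | succ e ih =>
      have : iterateFrobenius R p (e + 1) = (frobenius R p).comp (iterateFrobenius R p e) := by
        ext x
        simp [iterateFrobenius_def, frobenius_def, pow_succ, pow_mul]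
      rw [this]
      exact ⟨RingHom.Finite.comp hR ih.1, RingHom.Flat.comp ih.2 hflat⟩
  obtain ⟨n, φ, b, h1, h2⟩ := key.1.exists_dual_system key.2
  simp only [iterateFrobenius_def] at h1 h2
  exact ⟨n, φ, b, h1, h2⟩

/-! ### Frobenius powers and roots of ideals -/

namespace Ideal

variable {R : Type*} [CommRing R]

theorem bracketPow_mono {I J : Ideal R} (h : I ≤ J) (q : ℕ) : I.bracketPow q ≤ J.bracketPow q :=
  Ideal.span_mono (Set.image_mono h)

theorem pow_mem_bracketPow {I : Ideal R} {x : R} (h : x ∈ I) (q : ℕ) : x ^ q ∈ I.bracketPow q :=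
  Ideal.subset_span ⟨x, h, rfl⟩

theorem bracketPow_eq_map (p : ℕ) [ExpChar R p] (I : Ideal R) (e : ℕ) :
    I.bracketPow (p ^ e) = I.map (iterateFrobenius R p e) := rfl

theorem bracketPow_bracketPow (I : Ideal R) (p : ℕ) [ExpChar R p] (d e : ℕ) :
    (I.bracketPow (p ^ d)).bracketPow (p ^ e) = I.bracketPow (p ^ (d + e)) := by
  simp only [bracketPow_eq_map, Ideal.map_map]
  congr 1
  ext x
  simp [iterateFrobenius_def, pow_add, pow_mul]

theorem map_bracketPow {S : Type*} [CommRing S] (f : R →+* S) (I : Ideal R) (p : ℕ) [ExpChar R p]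
    [ExpChar S p] (e : ℕ) : (I.bracketPow (p ^ e)).map f = (I.map f).bracketPow (p ^ e) := by
  simp only [bracketPow_eq_map, Ideal.map_map]
  congr 1
  ext x
  simp [iterateFrobenius_def]

theorem map_mem_of_mem_bracketPow {J : Ideal R} {q : ℕ} {φ : R →+ R}
    (hφ : ∀ r x, φ (r ^ q * x) = r * φ x) {x : R} (hx : x ∈ J.bracketPow q) : φ x ∈ J := by
  -- `φ` is linear only over `q`-th powers, so the induction must carry arbitrary multiples of `x`.
  have key : ∀ s, φ (s * x) ∈ J := by
    refine Submodule.span_induction (p := fun x _ => ∀ s, φ (s * x) ∈ J) ?_ ?_ ?_ ?_ hx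
    · rintro _ ⟨f, hf, rfl⟩ s
      rw [mul_comm]
      simp only [hφ]
      exact J.mul_mem_right _ hf
    · simp
    · intro x y _ _ hx hy s
      rw [mul_add, map_add]
      exact J.add_mem (hx s) (hy s)
    · intro a x _ hx s
      rw [smul_eq_mul, ← mul_assoc]
      exact hx _
  simpa using key 1

section DualSystem

variable {ι : Type*} [Fintype ι] {q : ℕ} {φ : ι → R →+ R} {b : ι → R}

theorem mem_bracketPow_iff (h : IsDualSystem q φ b) {J : Ideal R} {x : R} :
    x ∈ J.bracketPow q ↔ ∀ i, φ i x ∈ J := by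
  refine ⟨fun hx i => map_mem_of_mem_bracketPow (h.map_pow_mul i) hx, fun hx => ?_⟩
  rw [h.sum_eq x]
  exact Ideal.sum_mem _ fun i _ => Ideal.mul_mem_right _ _ (pow_mem_bracketPow (hx i) q)

/-- The infimum is attained: `I ≤ J^[q]` means that all `φ i` send `I` into `J`, a condition stable
under intersecting the `J`. -/
theorem bracketRoot_le_iff (h : IsDualSystem q φ b) {I J : Ideal R} :
    I.bracketRoot q ≤ J ↔ I ≤ J.bracketPow q := by
  refine ⟨fun hIJ => le_trans (fun x hx => ?_) (bracketPow_mono hIJ q), fun hIJ => sInf_le hIJ⟩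
  rw [mem_bracketPow_iff h]
  intro i
  rw [bracketRoot, Submodule.mem_sInf]
  exact fun K hK => (mem_bracketPow_iff h).1 (hK hx) i

/-- Here `φ i (x^q) = x * φ i 1`, and the `φ i 1` generate the unit ideal because `1 = ∑ (φ i 1)^q *
b i`. -/
theorem mem_of_pow_mem_bracketPow (h : IsDualSystem q φ b) (hq : q ≠ 0) {J : Ideal R} {x : R}
    (hx : x ^ q ∈ J.bracketPow q) : x ∈ J := by
  have h1 : ∀ i, x * φ i 1 ∈ J := fun i => by
    have := (mem_bracketPow_iff h).1 hx i
    rwa [← mul_one (x ^ q), h.map_pow_mul] at this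
  have h2 : Ideal.span (Set.range fun i => φ i 1) = ⊤ := by
    rw [Ideal.eq_top_iff_one]
    have h3 : ∑ i, φ i 1 ^ q * b i ∈ Ideal.span (Set.range fun i => φ i 1) :=
      Ideal.sum_mem _ fun i _ => Ideal.mul_mem_right _ _
        (Ideal.pow_mem_of_mem _ (Ideal.subset_span (Set.mem_range_self i)) q (Nat.pos_of_ne_zero hq))
    rwa [← h.sum_eq 1] at h3
  have h4 : x ∈ Ideal.span {x} * Ideal.span (Set.range fun i => φ i 1) := by
    rw [h2, Ideal.mul_top]
    exact Ideal.mem_span_singleton_self x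
  rw [Ideal.span_mul_span', Set.singleton_mul] at h4
  refine (Ideal.span_le.2 ?_) h4
  rintro _ ⟨_, ⟨i, rfl⟩, rfl⟩
  exact h1 i

theorem bracketRoot_mono {I J : Ideal R} (h : I ≤ J) (q : ℕ) :
    I.bracketRoot q ≤ J.bracketRoot q :=
  sInf_le_sInf fun _ hK => h.trans hK

theorem bracketRoot_bracketPow_le (I : Ideal R) (q : ℕ) : (I.bracketPow q).bracketRoot q ≤ I :=
  sInf_le (le_refl (I.bracketPow q))

end DualSystem

end Ideal

/-! ### Coefficient ideals of polynomials -/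

namespace MvPolynomial

variable {σ R : Type*} [CommRing R]

/-- The ideal generated by the coefficients of a polynomial. -/
def coeffIdeal (f : MvPolynomial σ R) : Ideal R :=
  Ideal.span (Set.range fun u => f.coeff u)

theorem coeff_mem_coeffIdeal (f : MvPolynomial σ R) (u : σ →₀ ℕ) : f.coeff u ∈ f.coeffIdeal :=
  Ideal.subset_span ⟨u, rfl⟩

theorem coeffIdeal_le_iff {f : MvPolynomial σ R} {I : Ideal R} :
    f.coeffIdeal ≤ I ↔ ∀ u, f.coeff u ∈ I := by
  rw [coeffIdeal, Ideal.span_le, Set.range_subset_iff]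
  rfl

theorem coeffIdeal_mul_le (f g : MvPolynomial σ R) :
    (f * g).coeffIdeal ≤ f.coeffIdeal * g.coeffIdeal := by
  classical
  refine coeffIdeal_le_iff.2 fun u => ?_
  rw [coeff_mul]
  exact Ideal.sum_mem _ fun x _ =>
    Ideal.mul_mem_mul (coeff_mem_coeffIdeal f _) (coeff_mem_coeffIdeal g _)

theorem coeffIdeal_pderiv_le (f : MvPolynomial σ R) (i : σ) :
    (pderiv i f).coeffIdeal ≤ f.coeffIdeal := by
  refine coeffIdeal_le_iff.2 fun u => ?_
  rw [coeff_pderiv]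
  exact Ideal.mul_mem_right _ _ (coeff_mem_coeffIdeal f _)

theorem pow_eq_expand_map (p : ℕ) [ExpChar R p] (f : MvPolynomial σ R) (e : ℕ) :
    f ^ p ^ e = expand (p ^ e) (map (iterateFrobenius R p e) f) := by
  have : iterateFrobenius (MvPolynomial σ R) p e =
      ((expand (p ^ e) : MvPolynomial σ R →ₐ[R] MvPolynomial σ R) :
        MvPolynomial σ R →+* MvPolynomial σ R).comp (map (iterateFrobenius R p e)) := by
    refine ringHom_ext (fun r => ?_) (fun i => ?_)
    · simp [iterateFrobenius_def]
    · simp [iterateFrobenius_def]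
  exact congr($this f)

/-- The `R[z ^ q]`-linear projection of `R[z]` to the component spanned by the monomial `z ^ u`,
with `z ^ q` renamed to `z`. -/
noncomputable def extract (q : ℕ) (u : σ →₀ ℕ) : MvPolynomial σ R →ₗ[R] MvPolynomial σ R :=
  open Classical in
  (basisMonomials σ R).constr R fun w =>
    if w.mapRange (· % q) (Nat.zero_mod q) = u then
      monomial (w.mapRange (· / q) (Nat.zero_div q)) 1 else 0

open Classical in
theorem extract_monomial (q : ℕ) (u w : σ →₀ ℕ) (a : R) :
    extract q u (monomial w a) = if w.mapRange (· % q) (Nat.zero_mod q) = u then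
      monomial (w.mapRange (· / q) (Nat.zero_div q)) a else 0 := by
  have h : monomial w a = a • basisMonomials σ R w := by simp [smul_monomial]
  rw [h, map_smul, extract, Module.Basis.constr_basis]
  split_ifs <;> simp [smul_monomial]

theorem extract_expand_mul {q : ℕ} (hq : q ≠ 0) (u : σ →₀ ℕ) (h f : MvPolynomial σ R) :
    extract q u (expand q h * f) = h * extract q u f := by
  classical
  induction h using MvPolynomial.induction_on' with
  | add h₁ h₂ ih₁ ih₂ => rw [map_add, add_mul, map_add, ih₁, ih₂, add_mul]
  | monomial a α =>
    induction f using MvPolynomial.induction_on' with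
    | add f₁ f₂ ih₁ ih₂ => rw [mul_add, map_add, ih₁, ih₂, map_add, mul_add]
    | monomial w β =>
      have h1 : (q • a + w).mapRange (· % q) (Nat.zero_mod q) =
          w.mapRange (· % q) (Nat.zero_mod q) := by
        ext i
        simp
      have h2 : (q • a + w).mapRange (· / q) (Nat.zero_div q) =
          a + w.mapRange (· / q) (Nat.zero_div q) := by
        ext i
        simp [Nat.mul_add_div (Nat.pos_of_ne_zero hq)]
      rw [expand_monomial, monomial_mul, extract_monomial, extract_monomial, h1, h2, mul_ite,
        mul_zero, monomial_mul]

theorem extract_eq_C {q : ℕ} {f : MvPolynomial σ R} (hf : ∀ w ∈ f.support, ∀ i, w i < q)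
    (u : σ →₀ ℕ) : extract q u f = C (f.coeff u) := by
  classical
  conv_lhs => rw [f.as_sum, map_sum]
  have h : ∀ w ∈ f.support, extract q u (monomial w (f.coeff w)) =
      if w = u then C (f.coeff w) else 0 := by
    intro w hw
    have h1 : w.mapRange (· % q) (Nat.zero_mod q) = w := by
      ext i
      simpa using Nat.mod_eq_of_lt (hf w hw i)
    have h2 : w.mapRange (· / q) (Nat.zero_div q) = 0 := by
      ext i
      simpa using Nat.div_eq_of_lt (hf w hw i)
    rw [extract_monomial, h1, h2]
    rfl
  rw [Finset.sum_congr rfl h, Finset.sum_ite_eq']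
  split_ifs with hu
  · rfl
  · rw [notMem_support_iff.1 hu, C_0]

theorem coeffIdeal_extract_le (q : ℕ) (u : σ →₀ ℕ) (f : MvPolynomial σ R) :
    (extract q u f).coeffIdeal ≤ f.coeffIdeal := by
  classical
  refine coeffIdeal_le_iff.2 fun v => ?_
  rw [f.as_sum, map_sum, coeff_sum, ← f.as_sum]
  refine Ideal.sum_mem _ fun w _ => ?_
  rw [extract_monomial]
  split_ifs
  · rw [coeff_monomial]
    split_ifs
    · exact coeff_mem_coeffIdeal f w
    · exact zero_mem _
  · exact zero_mem _

theorem coeffIdeal_pow (p : ℕ) [ExpChar R p] (hp : p ≠ 0) (e : ℕ) (f : MvPolynomial σ R) :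
    (f ^ p ^ e).coeffIdeal = f.coeffIdeal.bracketPow (p ^ e) := by
  classical
  refine le_antisymm (coeffIdeal_le_iff.2 fun u => ?_) ?_
  · rw [pow_eq_expand_map]
    by_cases hu : u ∈ (expand (p ^ e) (map (iterateFrobenius R p e) f)).support
    · rw [support_expand _ (pow_ne_zero e hp), Finset.mem_image] at hu
      obtain ⟨v, -, rfl⟩ := hu
      rw [coeff_expand_smul _ (pow_ne_zero e hp), coeff_map, iterateFrobenius_def]
      exact Ideal.pow_mem_bracketPow (coeff_mem_coeffIdeal f v) _
    · rw [notMem_support_iff.1 hu]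
      exact zero_mem _
  · rw [Ideal.bracketPow_eq_map, coeffIdeal, Ideal.map_span, Ideal.span_le]
    rintro _ ⟨_, ⟨v, rfl⟩, rfl⟩
    have := coeff_mem_coeffIdeal (f ^ p ^ e) (p ^ e • v)
    rwa [pow_eq_expand_map, coeff_expand_smul _ (pow_ne_zero e hp), coeff_map,
      ← pow_eq_expand_map] at this

/-- The products `z^u * z^(qv)` with all entries of `u` below `q` are pairwise distinct, so
`extract` at `u` isolates `f_u` times the Frobenius twist of `g`. -/
theorem coeffIdeal_mul_pow (p : ℕ) [ExpChar R p] (hp : p ≠ 0) (e : ℕ) {f : MvPolynomial σ R}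
    (hf : ∀ u ∈ f.support, ∀ i, u i < p ^ e) (g : MvPolynomial σ R) :
    (f * g ^ p ^ e).coeffIdeal = f.coeffIdeal * g.coeffIdeal.bracketPow (p ^ e) := by
  refine le_antisymm ((coeffIdeal_mul_le _ _).trans (by rw [coeffIdeal_pow p hp])) ?_
  rw [Ideal.bracketPow_eq_map, coeffIdeal, coeffIdeal, Ideal.map_span, Ideal.span_mul_span',
    Ideal.span_le]
  rintro _ ⟨_, ⟨u, rfl⟩, _, ⟨_, ⟨v, rfl⟩, rfl⟩, rfl⟩
  have h1 : extract (p ^ e) u (f * g ^ p ^ e) =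
      C (f.coeff u) * map (iterateFrobenius R p e) g := by
    rw [mul_comm f, pow_eq_expand_map, extract_expand_mul (pow_ne_zero e hp), extract_eq_C hf,
      mul_comm]
  have h2 := coeffIdeal_extract_le _ _ _ (coeff_mem_coeffIdeal (extract (p ^ e) u (f * g ^ p ^ e)) v)
  rwa [h1, coeff_C_mul, coeff_map] at h2

end MvPolynomial

/-! ### Powers of the generic linear combination -/

section GenericComb

variable {R : Type*} [CommRing R] {m : ℕ} (g : Fin m → R)

open MvPolynomial

theorem totalDegree_genericComb_le : (genericComb g).totalDegree ≤ 1 := by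
  refine (totalDegree_finsetSum _ _).trans (Finset.sup_le fun i _ => ?_)
  refine (totalDegree_mul _ _).trans ?_
  rw [totalDegree_C, add_zero]
  refine (totalDegree_monomial_le _ _).trans ?_
  simp

theorem lt_of_mem_support_genericComb_pow {k q : ℕ} (hk : k < q) :
    ∀ u ∈ (genericComb g ^ k).support, ∀ i, u i < q := by
  intro u hu i
  calc u i ≤ u.degree := Finsupp.le_degree i u
    _ ≤ (genericComb g ^ k).totalDegree := le_totalDegree hu
    _ ≤ k * (genericComb g).totalDegree := totalDegree_pow _ _
    _ ≤ k * 1 := Nat.mul_le_mul_left k (totalDegree_genericComb_le g)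
    _ < q := by omega

theorem coeffIdeal_genericComb_le : (genericComb g).coeffIdeal ≤ Ideal.span (Set.range g) := by
  classical
  refine coeffIdeal_le_iff.2 fun u => ?_
  rw [genericComb, coeff_sum]
  refine Ideal.sum_mem _ fun i _ => ?_
  rw [mul_comm, coeff_C_mul]
  exact Ideal.mul_mem_right _ _ (Ideal.subset_span ⟨i, rfl⟩)

theorem pderiv_genericComb (i : Fin m) : pderiv i (genericComb g) = C (g i) := by
  classical
  simp [genericComb, Pi.single_apply]

/-- Differentiation replaces multinomial coefficients: `∂ᵢ G^(k+1) = (k+1) gᵢ G^k`, where `k + 1 <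
p` is a unit, and derivatives do not enlarge the coefficient ideal. -/
theorem coeffIdeal_genericComb_pow_of_lt (p : ℕ) [Fact p.Prime] [CharP R p] {k : ℕ} (hk : k < p) :
    (genericComb g ^ k).coeffIdeal = Ideal.span (Set.range g) ^ k := by
  induction k with
  | zero =>
    rw [pow_zero, pow_zero, Ideal.one_eq_top, Ideal.eq_top_iff_one]
    simpa using coeff_mem_coeffIdeal (1 : MvPolynomial (Fin m) R) 0
  | succ k ih =>
    refine le_antisymm ?_ ?_
    · rw [pow_succ, pow_succ, ← ih (by omega)]
      exact (coeffIdeal_mul_le _ _).trans (Ideal.mul_mono_right (coeffIdeal_genericComb_le g))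
    · rw [pow_succ', ← ih (by omega), coeffIdeal, Ideal.span_mul_span', Ideal.span_le]
      rintro _ ⟨_, ⟨i, rfl⟩, _, ⟨u, rfl⟩, rfl⟩
      have hu : IsUnit ((k + 1 : ℕ) : R) := by
        rw [CharP.isUnit_natCast_iff (Fact.out : p.Prime)]
        exact Nat.not_dvd_of_pos_of_lt k.succ_pos hk
      have h1 := coeffIdeal_pderiv_le _ i (coeff_mem_coeffIdeal (pderiv i (genericComb g ^ (k + 1))) u)
      have h2 : pderiv i (genericComb g ^ (k + 1)) =
          C (((k + 1 : ℕ) : R) * g i) * genericComb g ^ k := by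
        rw [pderiv_pow, pderiv_genericComb, Nat.add_sub_cancel, C_mul, map_natCast]
        ring
      rw [h2, coeff_C_mul, mul_assoc] at h1
      exact (Ideal.unit_mul_mem_iff_mem _ hu).1 h1

end GenericComb

theorem Ideal.bracketPow_one {R : Type*} [CommRing R] (I : Ideal R) : I.bracketPow 1 = I := by
  simp [bracketPow]

theorem Ideal.frobeniusPowNat_zero {R : Type*} [CommRing R] (p : ℕ) (I : Ideal R) :
    I.frobeniusPowNat p 0 = ⊤ := by
  simp [frobeniusPowNat]

/-! ### Integral Frobenius powers as coefficient ideals -/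

section FrobeniusPowNat

variable {R : Type*} [CommRing R] (p : ℕ) [Fact p.Prime] [CharP R p]

open MvPolynomial

namespace Ideal

theorem frobeniusPowNat_eq_mul (I : Ideal R) {k : ℕ} (hk : k ≠ 0) :
    I.frobeniusPowNat p k =
      I ^ (k % p) * (I.frobeniusPowNat p (k / p)).bracketPow p := by
  have hp := (Fact.out : p.Prime)
  have h1 : ∀ J : Ideal R, J.bracketPow p = Ideal.mapHom (iterateFrobenius R p 1) J := fun J => by
    have := bracketPow_eq_map p J 1
    rwa [pow_one] at this
  rw [frobeniusPowNat, Nat.digits_def' hp.one_lt (Nat.pos_of_ne_zero hk), List.length_cons,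
    Finset.prod_range_succ', mul_comm, h1, frobeniusPowNat, map_prod]
  congr 1
  · simp [bracketPow_one]
  · refine Finset.prod_congr rfl fun i _ => ?_
    rw [← h1, List.getD_cons_succ]
    have := bracketPow_bracketPow (I ^ (Nat.digits p (k / p)).getD i 0) p i 1
    rw [pow_one] at this
    exact this.symm

end Ideal

theorem coeffIdeal_genericComb_pow {m : ℕ} (g : Fin m → R) (k : ℕ) :
    (genericComb g ^ k).coeffIdeal = (Ideal.span (Set.range g)).frobeniusPowNat p k := by
  have hp := (Fact.out : p.Prime)
  induction k using Nat.strong_induction_on with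
  | _ k ih =>
    rcases eq_or_ne k 0 with rfl | hk
    · rw [Ideal.frobeniusPowNat_zero, coeffIdeal_genericComb_pow_of_lt g p hp.pos, pow_zero,
        Ideal.one_eq_top]
    · rw [Ideal.frobeniusPowNat_eq_mul p _ hk,
        ← ih (k / p) (Nat.div_lt_self (Nat.pos_of_ne_zero hk) hp.one_lt),
        ← coeffIdeal_genericComb_pow_of_lt g p (Nat.mod_lt k hp.pos)]
      have h := coeffIdeal_mul_pow p hp.ne_zero 1 (f := genericComb g ^ (k % p))
        (by rw [pow_one]; exact lt_of_mem_support_genericComb_pow g (Nat.mod_lt k hp.pos))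
        (genericComb g ^ (k / p))
      rw [pow_one, ← pow_mul, ← pow_add, mul_comm (k / p), Nat.mod_add_div] at h
      exact h

namespace Ideal

variable {m : ℕ} (g : Fin m → R)

/-- Passing to coefficients of `G^l = G^k * G^(l-k)` avoids comparing base `p` digits. -/
theorem frobeniusPowNat_anti {k l : ℕ} (hkl : k ≤ l) :
    (span (Set.range g)).frobeniusPowNat p l ≤ (span (Set.range g)).frobeniusPowNat p k := by
  rw [← coeffIdeal_genericComb_pow, ← coeffIdeal_genericComb_pow, ← Nat.add_sub_of_le hkl, pow_add]
  exact (coeffIdeal_mul_le _ _).trans Ideal.mul_le_left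

theorem frobeniusPowNat_mul_pow (k d : ℕ) :
    (span (Set.range g)).frobeniusPowNat p (k * p ^ d) =
      ((span (Set.range g)).frobeniusPowNat p k).bracketPow (p ^ d) := by
  rw [← coeffIdeal_genericComb_pow, ← coeffIdeal_genericComb_pow, pow_mul,
    coeffIdeal_pow p (Fact.out : p.Prime).ne_zero]

theorem frobeniusPowNat_pow (d : ℕ) :
    (span (Set.range g)).frobeniusPowNat p (p ^ d) = (span (Set.range g)).bracketPow (p ^ d) := by
  have h := coeffIdeal_genericComb_pow_of_lt g p (Fact.out : p.Prime).one_lt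
  rw [coeffIdeal_genericComb_pow p, pow_one] at h
  rw [← one_mul (p ^ d), frobeniusPowNat_mul_pow, h, one_mul]

/-- This contains the ascent of the chain defining `𝔞^[t]`. If `x ∈ 𝔞^[k]`, then `x^(p^d) ∈ 𝔞^[k
p^d] ⊆ 𝔞^[l]`, and a `p^d`-th root is taken inside the bracket power. -/
theorem frobeniusPowRat_le_of_le
    (hR : ∀ e, ∃ (n : ℕ) (φ : Fin n → R →+ R) (b : Fin n → R), IsDualSystem (p ^ e) φ b)
    {k l e d : ℕ} (hl : l ≤ k * p ^ d) :
    (span (Set.range g)).frobeniusPowRat p k e ≤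
      (span (Set.range g)).frobeniusPowRat p l (e + d) := by
  obtain ⟨_, _, _, he⟩ := hR e
  obtain ⟨_, _, _, hd⟩ := hR d
  obtain ⟨_, _, _, hed⟩ := hR (e + d)
  rw [frobeniusPowRat, bracketRoot_le_iff he]
  intro x hx
  refine mem_of_pow_mem_bracketPow hd (pow_ne_zero d (Fact.out : p.Prime).ne_zero) ?_
  rw [bracketPow_bracketPow]
  refine (bracketRoot_le_iff hed).1 le_rfl (frobeniusPowNat_anti p g hl ?_)
  rw [frobeniusPowNat_mul_pow]
  exact pow_mem_bracketPow hx _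

end Ideal

end FrobeniusPowNat

/-! ### Comparison over a localization of `R[z]` -/

section Localization

variable {R : Type*} [CommRing R] (p : ℕ) [Fact p.Prime] [CharP R p] {m : ℕ} (g : Fin m → R)

open MvPolynomial

/-- `Φ` applies `φ` to the coefficients of the component extracted at `u`; it carries the membership
test from `R` to `R[z]`. -/
theorem MvPolynomial.exists_addMonoidHom_extract {σ : Type*} {e : ℕ} (u : σ →₀ ℕ) {φ : R →+ R}
    (hφ : ∀ r x, φ (r ^ p ^ e * x) = r * φ x) :
    ∃ Φ : MvPolynomial σ R →+ MvPolynomial σ R, (∀ r x, Φ (r ^ p ^ e * x) = r * Φ x) ∧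
      ∀ f : MvPolynomial σ R, (∀ w ∈ f.support, ∀ i, w i < p ^ e) → Φ f = C (φ (f.coeff u)) := by
  classical
  let ψ : MvPolynomial σ R →+ MvPolynomial σ R :=
    { toFun := fun f => AddMonoidAlgebra.map φ f
      map_zero' := by ext; simp
      map_add' := fun x y => by ext; simp }
  have hψ : ∀ f v, (ψ f).coeff v = φ (f.coeff v) := fun f v => coeff_addMonoidAlgebraMap φ f v
  refine ⟨ψ.comp (extract (p ^ e) u).toAddMonoidHom, fun r x => ?_, fun f hf => ?_⟩
  · change ψ (extract (p ^ e) u (r ^ p ^ e * x)) = r * ψ (extract (p ^ e) u x)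
    rw [pow_eq_expand_map, extract_expand_mul (pow_ne_zero e (Fact.out : p.Prime).ne_zero)]
    ext v
    rw [hψ, coeff_mul, coeff_mul, map_sum]
    refine Finset.sum_congr rfl fun w _ => ?_
    rw [coeff_map, iterateFrobenius_def, hφ, hψ]
  · change ψ (extract (p ^ e) u f) = _
    rw [extract_eq_C hf]
    ext v
    rw [hψ, coeff_C, coeff_C]
    split_ifs
    · rfl
    · exact map_zero φ

theorem IsLocalization.map_mem_of_mem_bracketPow {A T : Type*} [CommRing A] [CommRing T]
    [ExpChar A p] [ExpChar T p] [Algebra A T] (W : Submonoid A) [IsLocalization W T] {e : ℕ}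
    {Φ : A →+ A} (hΦ : ∀ r x, Φ (r ^ p ^ e * x) = r * Φ x) {J : Ideal T} {x : A}
    (hx : algebraMap A T x ∈ J.bracketPow (p ^ e)) : algebraMap A T (Φ x) ∈ J := by
  have hJ : (J.comap (algebraMap A T)).map (algebraMap A T) = J := IsLocalization.map_under W T J
  rw [← hJ, ← Ideal.map_bracketPow, IsLocalization.algebraMap_mem_map_algebraMap_iff W] at hx
  obtain ⟨c, hc, hcx⟩ := hx
  -- The denominator `c` is raised to the power `p^e` so that it leaves `Φ` as `c`, a unit in `T`.
  have h1 : c ^ p ^ e * x ∈ (J.comap (algebraMap A T)).bracketPow (p ^ e) := by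
    obtain ⟨n, hn⟩ := Nat.exists_eq_succ_of_ne_zero (pow_ne_zero e (Fact.out : p.Prime).ne_zero)
    rw [hn, pow_succ, mul_assoc, ← hn]
    exact Ideal.mul_mem_left _ _ hcx
  have h2 := Ideal.map_mem_of_mem_bracketPow hΦ h1
  rw [hΦ, Ideal.mem_comap, map_mul] at h2
  exact (Ideal.unit_mul_mem_iff_mem _ (IsLocalization.map_units T ⟨c, hc⟩)).1 h2

variable {T : Type*} [CommRing T] [ExpChar T p] [Algebra (MvPolynomial (Fin m) R) T]
  (W : Submonoid (MvPolynomial (Fin m) R)) [IsLocalization W T]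

include W in
-- Because `k < p^e`, each `Φ` sends `G^k` to `φ i` of a single coefficient, so the test on `G^k`
-- becomes the test on generators of `𝔞^[k]`.
theorem frobeniusPowNat_le_of_genericComb_pow_mem {e k : ℕ} (hk : k < p ^ e) {ι : Type*}
    [Fintype ι] {φ : ι → R →+ R} {b : ι → R} (h : IsDualSystem (p ^ e) φ b) {J : Ideal T}
    (hJ : algebraMap (MvPolynomial (Fin m) R) T (genericComb g ^ k) ∈ J.bracketPow (p ^ e)) :
    (Ideal.span (Set.range g)).frobeniusPowNat p k ≤
      (J.comap ((algebraMap (MvPolynomial (Fin m) R) T).comp C)).bracketPow (p ^ e) := by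
  rw [← coeffIdeal_genericComb_pow, coeffIdeal_le_iff]
  intro u
  rw [Ideal.mem_bracketPow_iff h]
  intro i
  obtain ⟨Φ, hΦ, hΦC⟩ := MvPolynomial.exists_addMonoidHom_extract p u (h.map_pow_mul i)
  have h1 := IsLocalization.map_mem_of_mem_bracketPow p W hΦ hJ
  rwa [hΦC _ (lt_of_mem_support_genericComb_pow g hk)] at h1

theorem genericComb_pow_mem (T : Type*) [CommRing T] [Algebra (MvPolynomial (Fin m) R) T] (k : ℕ) :
    algebraMap (MvPolynomial (Fin m) R) T (genericComb g ^ k) ∈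
      ((Ideal.span (Set.range g)).frobeniusPowNat p k).map
        ((algebraMap (MvPolynomial (Fin m) R) T).comp C) := by
  rw [← Ideal.map_map]
  refine Ideal.mem_map_of_mem _ ?_
  rw [mem_map_C_iff, ← coeffIdeal_le_iff, coeffIdeal_genericComb_pow]

variable (hR : ∀ e, ∃ (n : ℕ) (φ : Fin n → R →+ R) (b : Fin n → R), IsDualSystem (p ^ e) φ b)

include hR in
theorem bracketRoot_span_genericComb_pow_le (k e : ℕ) :
    (Ideal.span {algebraMap (MvPolynomial (Fin m) R) T (genericComb g)} ^ k).bracketRoot (p ^ e) ≤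
      ((Ideal.span (Set.range g)).frobeniusPowRat p k e).map
        ((algebraMap (MvPolynomial (Fin m) R) T).comp C) := by
  obtain ⟨_, _, _, he⟩ := hR e
  refine sInf_le ?_
  rw [Set.mem_ofPred_eq, Ideal.span_singleton_pow, Ideal.span_singleton_le_iff_mem, ← map_pow,
    ← Ideal.map_bracketPow]
  exact Ideal.map_mono ((Ideal.bracketRoot_le_iff he).1 le_rfl) (genericComb_pow_mem p g T k)

include hR W in
theorem le_bracketRoot_span_genericComb_pow {k e : ℕ} (hk : k < p ^ e) :
    ((Ideal.span (Set.range g)).frobeniusPowRat p k e).map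
        ((algebraMap (MvPolynomial (Fin m) R) T).comp C) ≤
      (Ideal.span {algebraMap (MvPolynomial (Fin m) R) T (genericComb g)} ^ k).bracketRoot
        (p ^ e) := by
  obtain ⟨_, _, _, he⟩ := hR e
  refine le_sInf fun J hJ => ?_
  rw [Set.mem_ofPred_eq, Ideal.span_singleton_pow, Ideal.span_singleton_le_iff_mem,
    ← map_pow] at hJ
  rw [Ideal.map_le_iff_le_comap, Ideal.frobeniusPowRat, Ideal.bracketRoot_le_iff he]
  exact frobeniusPowNat_le_of_genericComb_pow_mem p g W hk he hJ

/-- Rounding up may reach `p^e` for small `e`; it cannot once `p^e (1 - t) > 1`. -/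
theorem exists_ceil_lt_pow {t : ℝ≥0} (ht : t < 1) (e : ℕ) :
    ∃ d, ⌈(p : ℝ≥0) ^ (e + d) * t⌉₊ < p ^ (e + d) := by
  have hp : 1 < (p : ℝ) := by exact_mod_cast (Fact.out : p.Prime).one_lt
  have ht' : (0 : ℝ) < 1 - t := by
    rw [sub_pos]
    exact_mod_cast ht
  obtain ⟨d, hd⟩ := pow_unbounded_of_one_lt (1 / (1 - (t : ℝ))) hp
  refine ⟨d, ?_⟩
  have h1 : (p : ℝ) ^ d ≤ (p : ℝ) ^ (e + d) := pow_le_pow_right₀ hp.le (by omega)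
  have h2 : 1 < (p : ℝ) ^ (e + d) * (1 - t) := by
    rw [div_lt_iff₀ ht'] at hd
    exact hd.trans_le (mul_le_mul_of_nonneg_right h1 ht'.le)
  have h3 := Nat.ceil_lt_add_one (zero_le : 0 ≤ (p : ℝ≥0) ^ (e + d) * t)
  have h4 : (⌈(p : ℝ≥0) ^ (e + d) * t⌉₊ : ℝ) < (p : ℝ) ^ (e + d) * t + 1 := by exact_mod_cast h3
  have h5 : (⌈(p : ℝ≥0) ^ (e + d) * t⌉₊ : ℝ) < (p : ℝ) ^ (e + d) := by linarith
  exact_mod_cast h5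

include hR W in
-- One inclusion holds level by level. The other needs `⌈p^e t⌉ < p^e`, so level `e` is first pushed
-- to a deeper level `e + d`, using `⌈p^(e+d) t⌉ ≤ ⌈p^e t⌉ p^d`.
theorem testIdeal_genericComb_eq_map {t : ℝ≥0} (ht : t < 1) :
    (Ideal.span {algebraMap (MvPolynomial (Fin m) R) T (genericComb g)}).testIdeal p t =
      ((Ideal.span (Set.range g)).frobeniusPow p t).map
        ((algebraMap (MvPolynomial (Fin m) R) T).comp C) := by
  rw [Ideal.testIdeal, Ideal.frobeniusPow, Ideal.map_iSup]
  refine le_antisymm (iSup_mono fun e => bracketRoot_span_genericComb_pow_le p g hR _ e)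
    (iSup_le fun e => ?_)
  obtain ⟨d, hd⟩ := exists_ceil_lt_pow p ht e
  refine le_trans ?_ (le_iSup _ (e + d))
  refine le_trans (Ideal.map_mono ?_) (le_bracketRoot_span_genericComb_pow p g W hR hd)
  refine Ideal.frobeniusPowRat_le_of_le p g hR (Nat.ceil_le.2 ?_)
  rw [pow_add, mul_right_comm]
  push_cast
  gcongr
  exact Nat.le_ceil _

omit [Fact p.Prime] in
theorem pow_le_ceil_pow_mul {t : ℝ≥0} (ht : 1 ≤ t) (e : ℕ) : p ^ e ≤ ⌈(p : ℝ≥0) ^ e * t⌉₊ := by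
  have h1 : (p : ℝ≥0) ^ e ≤ (p : ℝ≥0) ^ e * t := le_mul_of_one_le_right zero_le ht
  exact_mod_cast h1.trans (Nat.le_ceil _)

theorem frobeniusPow_le_of_one_le {t : ℝ≥0} (ht : 1 ≤ t) :
    (Ideal.span (Set.range g)).frobeniusPow p t ≤ Ideal.span (Set.range g) := by
  refine iSup_le fun e => ?_
  refine le_trans (Ideal.bracketRoot_mono
    (Ideal.frobeniusPowNat_anti p g (pow_le_ceil_pow_mul p ht e)) _) ?_
  rw [Ideal.frobeniusPowNat_pow]
  exact Ideal.bracketRoot_bracketPow_le _ _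

omit [Fact p.Prime] in
theorem Ideal.testIdeal_le_of_one_le {S : Type*} [CommRing S] (x : S) {t : ℝ≥0} (ht : 1 ≤ t) :
    (Ideal.span {x}).testIdeal p t ≤ Ideal.span {x} := by
  refine iSup_le fun e => ?_
  refine le_trans (Ideal.bracketRoot_mono (Ideal.pow_le_pow_right (pow_le_ceil_pow_mul p ht e)) _)
    (sInf_le ?_)
  rw [Set.mem_ofPred_eq, Ideal.span_singleton_pow, Ideal.span_singleton_le_iff_mem]
  exact Ideal.pow_mem_bracketPow (Ideal.mem_span_singleton_self x) _

include hR W in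
theorem lce_eq_fpt_genericComb
    (hT : ∀ I : Ideal R, (I.map ((algebraMap (MvPolynomial (Fin m) R) T).comp C)).comap
      ((algebraMap (MvPolynomial (Fin m) R) T).comp C) = I)
    (hg : Ideal.span (Set.range g) ≠ ⊤) :
    (Ideal.span (Set.range g)).lce p =
      (Ideal.span {algebraMap (MvPolynomial (Fin m) R) T (genericComb g)}).fpt p := by
  have hmap : ∀ I : Ideal R, I.map ((algebraMap (MvPolynomial (Fin m) R) T).comp C) = ⊤ →
      I = ⊤ := fun I hI => by
    rw [← hT I, hI, Ideal.comap_top]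
  have key : ∀ t : ℝ≥0, (Ideal.span (Set.range g)).frobeniusPow p t = ⊤ ↔
      (Ideal.span {algebraMap (MvPolynomial (Fin m) R) T (genericComb g)}).testIdeal p t = ⊤ := by
    intro t
    rcases lt_or_ge t 1 with ht | ht
    · rw [testIdeal_genericComb_eq_map p g W hR ht]
      exact ⟨fun h => by rw [h, Ideal.map_top], hmap _⟩
    · refine iff_of_false (fun h => hg (top_le_iff.1 (h ▸ frobeniusPow_le_of_one_le p g ht)))
        fun h => hg (hmap _ (top_le_iff.1 ?_))
      rw [← h]
      refine (Ideal.testIdeal_le_of_one_le p _ ht).trans ?_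
      rw [Ideal.span_singleton_le_iff_mem, ← Ideal.map_map]
      refine Ideal.mem_map_of_mem _ ?_
      rw [mem_map_C_iff, ← coeffIdeal_le_iff]
      exact coeffIdeal_genericComb_le g
  simp only [Ideal.lce, Ideal.fpt, key]

end Localization

/-! ### The rings `R ⊗ k(z)` and `k(z)[x]` as localizations -/

open MvPolynomial

/-- The structure map of `R ⊗ₖ k(z)` as a localization of `R[z]`. -/
noncomputable def polyToTensor (k R : Type*) [Field k] [CommRing R] [Algebra k R] (m : ℕ) :
    MvPolynomial (Fin m) R →+* R ⊗[k] RatFunField m k :=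
  (Algebra.TensorProduct.map (AlgHom.id R R)
    (IsScalarTower.toAlgHom k (MvPolynomial (Fin m) k) (RatFunField m k))).toRingHom.comp
    (algebraTensorAlgEquiv k R).symm.toRingEquiv.toRingHom

section PolyToTensor

variable (k : Type*) {R : Type*} [Field k] [CommRing R] [Algebra k R] {m : ℕ}

theorem polyToTensor_C (r : R) : polyToTensor k R m (C r) = r ⊗ₜ 1 := by
  have h : (algebraTensorAlgEquiv k R).symm (C r : MvPolynomial (Fin m) R) = r ⊗ₜ 1 := by
    rw [AlgEquiv.symm_apply_eq, algebraTensorAlgEquiv_tmul, map_one, smul_eq_C_mul, mul_one]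
  change Algebra.TensorProduct.map _ _ ((algebraTensorAlgEquiv k R).symm (C r)) = _
  rw [h, Algebra.TensorProduct.map_tmul, map_one]
  rfl

theorem polyToTensor_X (i : Fin m) : polyToTensor k R m (X i) = 1 ⊗ₜ ratVar k i := by
  change Algebra.TensorProduct.map _ _ ((algebraTensorAlgEquiv k R).symm (X i)) = _
  rw [algebraTensorAlgEquiv_symm_X, Algebra.TensorProduct.map_tmul, map_one]
  rfl

theorem polyToTensor_genericComb (g : Fin m → R) :
    polyToTensor k R m (genericComb g) = genericCombTensor k g := by
  simp [genericComb, genericCombTensor, polyToTensor_C, polyToTensor_X]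

theorem polyToTensor_comp_C :
    (polyToTensor k R m).comp C = algebraMap R (R ⊗[k] RatFunField m k) := by
  ext r
  exact polyToTensor_C k r

/-- This is the localization `k[z] → k(z)` base changed along `k → R`, so the denominators are the
nonzero polynomials over `k`. -/
theorem exists_isLocalization_polyToTensor :
    ∃ W : Submonoid (MvPolynomial (Fin m) R),
      @IsLocalization _ _ W (R ⊗[k] RatFunField m k) _ (polyToTensor k R m).toAlgebra := by
  let f := (Algebra.TensorProduct.map (AlgHom.id R R)
    (IsScalarTower.toAlgHom k (MvPolynomial (Fin m) k) (RatFunField m k)))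
  let _ : Algebra (R ⊗[k] MvPolynomial (Fin m) k) (R ⊗[k] RatFunField m k) := f.toRingHom.toAlgebra
  have : IsScalarTower R (R ⊗[k] MvPolynomial (Fin m) k) (R ⊗[k] RatFunField m k) :=
    IsScalarTower.of_algebraMap_eq fun r => (f.commutes r).symm
  have hloc := IsLocalization.tensorProduct_tensorProduct_right k R
    (nonZeroDivisors (MvPolynomial (Fin m) k)) (RatFunField m k) (by
      refine RingHom.ext fun x => ?_
      change f (1 ⊗ₜ x) = 1 ⊗ₜ algebraMap _ _ x
      simp [f])
  exact ⟨_, IsLocalization.isLocalization_of_base_ringEquiv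
    ((nonZeroDivisors (MvPolynomial (Fin m) k)).map
      (Algebra.TensorProduct.includeRight (R := k) (A := R))) (R ⊗[k] RatFunField m k)
    (algebraTensorAlgEquiv (σ := Fin m) k R).toRingEquiv⟩

theorem comap_map_polyToTensor (I : Ideal R) :
    (I.map ((polyToTensor k R m).comp C)).comap ((polyToTensor k R m).comp C) = I := by
  rw [polyToTensor_comp_C]
  exact Ideal.comap_map_eq_self_of_faithfullyFlat I

theorem charP_tensor (p : ℕ) [CharP R p] : CharP (R ⊗[k] RatFunField m k) p := 
  charP_of_injective_algebraMap (FaithfulSMul.algebraMap_injective R _) p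

end PolyToTensor

section PolyIncl

variable (k : Type*) [Field k] (m n : ℕ)

/-- The isomorphism of `k[x] ⊗ₖ k(z)` with `k(z)[x]`. -/
noncomputable def tensorPolyEquiv :
    MvPolynomial (Fin n) k ⊗[k] RatFunField m k ≃+* MvPolynomial (Fin n) (RatFunField m k) :=
  (Algebra.TensorProduct.comm k (MvPolynomial (Fin n) k) (RatFunField m k)).toRingEquiv.trans
    (algebraTensorAlgEquiv k (RatFunField m k)).toRingEquiv

theorem tensorPolyEquiv_tmul (f : MvPolynomial (Fin n) k) (a : RatFunField m k) :
    tensorPolyEquiv k m n (f ⊗ₜ a) = C a * polyIncl k m n f := by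
  change algebraTensorAlgEquiv k (RatFunField m k) (a ⊗ₜ f) = _
  rw [algebraTensorAlgEquiv_tmul, smul_eq_C_mul]
  rfl

theorem tensorPolyEquiv_genericCombTensor (g : Fin m → MvPolynomial (Fin n) k) :
    tensorPolyEquiv k m n (genericCombTensor k g) = genericCombPoly g := by
  simp [genericCombTensor, genericCombPoly, tensorPolyEquiv_tmul]

/-- The structure map of `k(z)[x]` as a localization of `k[x][z]`. -/
noncomputable def polyToPoly :
    MvPolynomial (Fin m) (MvPolynomial (Fin n) k) →+* MvPolynomial (Fin n) (RatFunField m k) :=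
  (tensorPolyEquiv k m n).toRingHom.comp (polyToTensor k (MvPolynomial (Fin n) k) m)

theorem polyToPoly_genericComb (g : Fin m → MvPolynomial (Fin n) k) :
    polyToPoly k m n (genericComb g) = genericCombPoly g := by
  rw [← tensorPolyEquiv_genericCombTensor, ← polyToTensor_genericComb]
  rfl

theorem polyToPoly_comp_C : (polyToPoly k m n).comp C = polyIncl k m n := by
  refine RingHom.ext fun f => ?_
  change tensorPolyEquiv k m n (polyToTensor k (MvPolynomial (Fin n) k) m (C f)) = _
  rw [polyToTensor_C, tensorPolyEquiv_tmul, C_1, one_mul]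

theorem exists_isLocalization_polyToPoly :
    ∃ W : Submonoid (MvPolynomial (Fin m) (MvPolynomial (Fin n) k)),
      @IsLocalization _ _ W (MvPolynomial (Fin n) (RatFunField m k)) _
        (polyToPoly k m n).toAlgebra := by
  obtain ⟨W, hW⟩ := exists_isLocalization_polyToTensor k (R := MvPolynomial (Fin n) k) (m := m)
  let _ := (polyToTensor k (MvPolynomial (Fin n) k) m).toAlgebra
  let _ := (polyToPoly k m n).toAlgebra
  exact ⟨W, IsLocalization.isLocalization_of_algEquiv W
    (AlgEquiv.ofRingEquiv (f := tensorPolyEquiv k m n) fun x => rfl)⟩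

theorem comap_map_polyIncl (I : Ideal (MvPolynomial (Fin n) k)) :
    (I.map (polyIncl k m n)).comap (polyIncl k m n) = I := by
  conv_rhs => rw [← comap_map_polyToTensor k (m := m) I]
  rw [← polyToPoly_comp_C]
  have h : (polyToPoly k m n).comp C = (tensorPolyEquiv k m n).toRingHom.comp
    ((polyToTensor k (MvPolynomial (Fin n) k) m).comp C) := rfl
  rw [h, ← Ideal.map_map, ← Ideal.comap_comap]
  congr 1
  exact Ideal.comap_map_of_bijective _ (tensorPolyEquiv k m n).bijective

theorem charP_poly (p : ℕ) [CharP k p] : CharP (MvPolynomial (Fin n) (RatFunField m k)) p :=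
  charP_of_injective_algebraMap (algebraMap k _).injective p

end PolyIncl

/-- Frobenius is of finite type, and integral because `x` is a root of `X^p - x` over it. -/
theorem MvPolynomial.isFFinite (p : ℕ) [Fact p.Prime] {σ R : Type*} [Finite σ] [CommRing R]
    [CharP R p] (hR : IsFFinite p R) : IsFFinite p (MvPolynomial σ R) := by
  have hC : (C : R →+* MvPolynomial σ R).FiniteType :=
    RingHom.finiteType_algebraMap.2 inferInstance
  have h1 : ((frobenius (MvPolynomial σ R) p).comp C).FiniteType := by
    have : (frobenius (MvPolynomial σ R) p).comp C =
        (C : R →+* MvPolynomial σ R).comp (frobenius R p) := by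
      ext x
      simp [frobenius_def]
    rw [this]
    exact hC.comp hR.finiteType
  refine RingHom.IsIntegral.to_finite (fun x => ?_) (RingHom.FiniteType.of_comp_finiteType h1)
  refine ⟨Polynomial.X ^ p - Polynomial.C x,
    Polynomial.monic_X_pow_sub_C x (Fact.out : p.Prime).ne_zero, ?_⟩
  simp [frobenius_def]

theorem MvPolynomial.comap_map_C {σ R : Type*} [CommRing R] (I : Ideal R) :
    (I.map (C : R →+* MvPolynomial σ R)).comap C = I := by
  classical
  refine le_antisymm (fun x hx => ?_) Ideal.le_comap_map
  simpa using mem_map_C_iff.1 hx 0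

theorem mainTheorem2 (p : ℕ) [Fact p.Prime] :
    -- an arbitrary `F`-finite regular domain `R`, with `G` in `R[z]` or in `R ⊗ₖ k(z)`
    (∀ (R : Type*) [CommRing R] [IsDomain R] [IsRegularRing R] [CharP R p], IsFFinite p R →
      ∀ (m : ℕ) (g : Fin m → R),
        Ideal.span (Set.range g) ≠ ⊥ → Ideal.span (Set.range g) ≠ ⊤ →
        (Ideal.span (Set.range g)).lce p = (Ideal.span {genericComb g}).fpt p ∧
        ∀ (k : Type*) [Field k] [CharP k p] [Algebra k R], IsFFinite p k →
          (Ideal.span (Set.range g)).lce p = (Ideal.span {genericCombTensor k g}).fpt p) ∧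
    -- a polynomial ring `k[x]`, with `G` in `k(z)[x]`
    (∀ (k : Type*) [Field k] [CharP k p], IsFFinite p k →
      ∀ (m n : ℕ) (g : Fin m → MvPolynomial (Fin n) k),
        (∀ t : ℝ≥0, 0 < t → t < 1 →
          (Ideal.span {genericCombPoly g}).testIdeal p t =
            ((Ideal.span (Set.range g)).frobeniusPow p t).map (polyIncl k m n) ∧
          (Ideal.span (Set.range g)).frobeniusPow p t =
            ((Ideal.span {genericCombPoly g}).testIdeal p t).comap (polyIncl k m n)) ∧
        (Ideal.span (Set.range g) ≠ ⊥ → Ideal.span (Set.range g) ≠ ⊤ →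
          (Ideal.span {genericCombPoly g}).fpt p = (Ideal.span (Set.range g)).lce p)) := by
  refine ⟨fun R _ _ _ _ hR m g _ hg => ⟨?_, fun k _ _ _ _ => ?_⟩, fun k _ _ hk m n g => ?_⟩
  -- `R[z]` is its own localization at its units.
  · exact lce_eq_fpt_genericComb p g (T := MvPolynomial (Fin m) R) (IsUnit.submonoid _)
      (IsRegularRing.exists_isDualSystem p R hR) comap_map_C hg
  · obtain ⟨W, hW⟩ := exists_isLocalization_polyToTensor k (R := R) (m := m)
    let _ := (polyToTensor k R m).toAlgebra
    have := charP_tensor k (R := R) (m := m) p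
    have h := lce_eq_fpt_genericComb p g (T := R ⊗[k] RatFunField m k) W
      (IsRegularRing.exists_isDualSystem p R hR) (comap_map_polyToTensor k) hg
    rwa [RingHom.algebraMap_toAlgebra, polyToTensor_genericComb] at h
  · obtain ⟨W, hW⟩ := exists_isLocalization_polyToPoly k m n
    let _ := (polyToPoly k m n).toAlgebra
    have := charP_poly k m n p
    have hR := IsRegularRing.exists_isDualSystem p (MvPolynomial (Fin n) k)
      (MvPolynomial.isFFinite p hk)
    have hC : (algebraMap (MvPolynomial (Fin m) (MvPolynomial (Fin n) k))
      (MvPolynomial (Fin n) (RatFunField m k))).comp C = polyIncl k m n := polyToPoly_comp_C k m n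
    have hG : algebraMap _ (MvPolynomial (Fin n) (RatFunField m k)) (genericComb g) =
      genericCombPoly g := polyToPoly_genericComb k m n g
    refine ⟨fun t _ ht => ?_, fun _ hg => ?_⟩
    · have h := testIdeal_genericComb_eq_map p g (T := MvPolynomial (Fin n) (RatFunField m k))
        W hR ht
      rw [hC, hG] at h
      exact ⟨h, by rw [h, comap_map_polyIncl]⟩
    · have h := lce_eq_fpt_genericComb p g (T := MvPolynomial (Fin n) (RatFunField m k)) W hR
        (by rw [hC]; exact comap_map_polyIncl k m n) hg
      rw [hG] at h
      exact h.symm
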